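/- Let $V \subseteq \mathbb{Z}^2$ be infinite and connected in the nearest-neighbor graph $(\mathbb{Z}^2, \mathcal{E}^2)$, with infinite connected complement, and let $E$ be the set of edges in $\mathcal{E}^2$ with both endpoints in $V$. The dual lattice is $(\mathbb{Z}^2, \mathcal{E}^2)$ shifted by $(1/2,1/2)$; the edge dual to $e \in \mathcal{E}^2$ is the dual-lattice edge $e^*$ that bisects $e$. Then the dual edges of the edges between $V$ and $V^c$ form a doubly infinite dual path $\Gamma = (e_i^*)_{i \in \mathbb{Z}}$ without vertex self-intersections. Fix any such enumeration of the edges of $\Gamma$ along the path, in either orientation, and let $v_i$ be the endpoint in $V$ of the edge $e_i$ dual to $e_i^*$. For $\omega = (\omega_e)_{e \in E} \in [0,\infty)^E$ and $x, y \in V$, let $\tau(x,y)$ be the infimum of $\sum_{e \in \gamma} \omega_e$ over all finite paths $\gamma$ from $x$ to $y$ in $(V,E)$, and let $$B_n(x,y) = \tau(x,v_n) - \tau(y,v_n), \qquad n \in \mathbb{Z}.$$ Then for every $\omega \in [0,\infty)^E$ and all $x, y \in V$ the limit $$B(x,y) = \lim_{n \to \infty} B_n(x,y)$$ exists in $\mathbb{R}$.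 Moreover, on the boundary the convergence is monotone: if $x = v_i$ and $y = v_j$ with $i \le j$, then $B_n(x,y)$ is nonincreasing in $n$ for $n \ge j$ (and hence $B_n(y,x) = -B_n(x,y)$ is nondecreasing in $n$ for $n \ge j$). -/

import Mathlib

open Filter Topology
open scoped NNReal

noncomputable section

/-- The square lattice: the nearest-neighbour graph on `ℤ²`. -/
def squareLattice : SimpleGraph (ℤ × ℤ) where
  Adj p q := |p.1 - q.1| + |p.2 - q.2| = 1
  symm := ⟨fun p q h => by rwa [abs_sub_comm q.1, abs_sub_comm q.2]⟩
  loopless := ⟨fun p h => by simp at h⟩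

/-- The graph `(V, E)`, where `E` is the set of lattice edges with both endpoints in `V`. -/
abbrev latticeOn (V : Set (ℤ × ℤ)) : SimpleGraph V := squareLattice.induce V

/-- A pair `d : ℤ × ℤ` is also used as a name for the dual vertex `d + (1/2, 1/2)`.
`Bisects d d' p q` says that `{p, q}` is an edge of the lattice, that the dual vertices named
`d` and `d'` span an edge of the dual lattice, and that these two edges have the same midpoint,
i.e. the dual edge is the one dual to `{p, q}`. -/
def Bisects (d d' p q : ℤ × ℤ) : Prop :=
  squareLattice.Adj d d' ∧ squareLattice.Adj p q ∧ p + q = d + d' + (1, 1)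

/-- The dual vertices `w i` are the consecutive vertices of a doubly infinite, vertex
self-avoiding dual path `Γ`, whose edges are exactly the dual edges of the edge boundary of `V`
(the edges between `V` and its complement), and `v i` is the endpoint in `V` of the boundary
edge bisected by the `i`-th edge of `Γ`. -/
structure IsBoundaryPath (V : Set (ℤ × ℤ)) (w : ℤ → ℤ × ℤ) (v : ℤ → V) : Prop where
  selfAvoiding : Function.Injective w
  crosses : ∀ i : ℤ, ∃ q : ℤ × ℤ, q ∉ V ∧ Bisects (w i) (w (i + 1)) (v i) q
  exhausts : ∀ p q : ℤ × ℤ, p ∈ V → q ∉ V → squareLattice.Adj p q →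
    ∃ i : ℤ, Bisects (w i) (w (i + 1)) p q

/-- A passage-time configuration on `(V, E)`: an element of `[0, ∞)^E`. -/
abbrev Configuration (V : Set (ℤ × ℤ)) : Type := (latticeOn V).edgeSet → ℝ≥0

/-- The passage time of a path: the sum of the weights of its edges. -/
def pathTime {V : Set (ℤ × ℤ)} (ω : Configuration V) :
    {x y : V} → (latticeOn V).Walk x y → ℝ
  | _, _, .nil => 0
  | x, _, .cons (v := z) h γ => (ω ⟨s(x, z), h⟩ : ℝ) + pathTime ω γ

/-- The passage time `τ(x, y)`: the infimum of the passage times of the paths in `(V, E)` from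
`x` to `y`. -/
def passageTime {V : Set (ℤ × ℤ)} (ω : Configuration V) (x y : V) : ℝ :=
  ⨅ γ : (latticeOn V).Walk x y, pathTime ω γ

/-- The Busemann function `B_n(x, y) = τ(x, v_n) - τ(y, v_n)`. -/
def busemann {V : Set (ℤ × ℤ)} (ω : Configuration V) (v : ℤ → V) (n : ℤ) (x y : V) : ℝ :=
  passageTime ω x (v n) - passageTime ω y (v n)

end

/-! On the boundary the limit comes from planarity. For i ≤ j ≤ n ≤ m, a path in V from v_i to v_n
meets every path in V from v_j to v_m (`exists_mem_support`). Exchanging tails at a common vertex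
gives τ(v_i,v_m) + τ(v_j,v_n) ≤ τ(v_i,v_n) + τ(v_j,v_m) (`passageTime_exchange`), which is the
monotonicity of B_n(v_i,v_j); the triangle inequality bounds it below.

A general point x is reduced to this case by cutting V open. Let K be the vertex set of a path from
x to v_0, and V' the component of V \ K containing v_n for all large n. Then V' satisfies the
hypotheses on V (`exists_component`), and its boundary path has the same tail (`exists_tail_index`).
For a ∈ K, splitting paths at their last entrance into V' writes τ(a,v_n) as a minimum over finitely
many entrance edges, whose inner endpoints lie on the boundary of V'. Up to a reference term
independent of a, each entry of the minimum converges by the boundary case.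

Stream functions (`exists_stream`) play the role of the Jordan curve theorem: an antisymmetric
divergence-free flow on the lattice is the gradient of a function on the dual lattice. This yields
the path Γ (`leftStep_injective`, `leftStep_exhausts`) as well as the crossing of paths. -/

/-! ### Lattice edges and their dual edges -/

theorem squareLattice_adj_iff {p q : ℤ × ℤ} : squareLattice.Adj p q ↔
    (q.1 = p.1 + 1 ∧ q.2 = p.2) ∨ (q.1 = p.1 - 1 ∧ q.2 = p.2) ∨
    (q.1 = p.1 ∧ q.2 = p.2 + 1) ∨ (q.1 = p.1 ∧ q.2 = p.2 - 1) := by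
  change |p.1 - q.1| + |p.2 - q.2| = 1 ↔ _
  grind

/-- `Crosses d d' p q` is the oriented form of `Bisects d d' p q`: the vertex `p` lies to the left
of the dual edge from `d` to `d'`. -/
def Crosses (d d' p q : ℤ × ℤ) : Prop :=
  squareLattice.Adj d d' ∧ p + q = d + d' + (1, 1) ∧ p.1 - q.1 = d.2 - d'.2 ∧
    p.2 - q.2 = d'.1 - d.1

theorem Crosses.reverse {d d' p q : ℤ × ℤ} (h : Crosses d d' p q) : Crosses d' d q p := by
  simp only [Crosses, squareLattice_adj_iff, Prod.ext_iff, Prod.fst_add, Prod.snd_add] at *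
  omega

/-- Two half-shifts add up to (1, 1). This form is for flows on the lattice itself, whose stream
function lives at dual vertices. -/
theorem Crosses.swap {d d' p q : ℤ × ℤ} (h : Crosses d d' p q) :
    Crosses q p (d + (1, 1)) (d' + (1, 1)) := by
  simp only [Crosses, squareLattice_adj_iff, Prod.ext_iff, Prod.fst_add, Prod.snd_add] at *
  omega

theorem Crosses.bisects {d d' p q : ℤ × ℤ} (h : Crosses d d' p q) : Bisects d d' p q := by
  simp only [Bisects, Crosses, squareLattice_adj_iff, Prod.ext_iff, Prod.fst_add,
    Prod.snd_add] at *
  omega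

theorem bisects_iff_crosses {d d' p q : ℤ × ℤ} :
    Bisects d d' p q ↔ Crosses d d' p q ∨ Crosses d d' q p := by
  simp only [Bisects, Crosses, squareLattice_adj_iff, Prod.ext_iff, Prod.fst_add, Prod.snd_add]
  constructor
  · rintro ⟨h | h | h | h, h' | h' | h' | h', h1, h2⟩ <;> omega
  · rintro (⟨h | h | h | h, ⟨h1, h2⟩, h3, h4⟩ | ⟨h | h | h | h, ⟨h1, h2⟩, h3, h4⟩) <;> omega

theorem Bisects.reverse {d d' p q : ℤ × ℤ} (h : Bisects d d' p q) : Bisects d' d p q :=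
  ⟨h.1.symm, h.2.1, by rw [add_comm d']; exact h.2.2⟩

theorem exists_crosses {p q : ℤ × ℤ} (h : squareLattice.Adj p q) : ∃ d d', Crosses d d' p q := by
  have key : ∀ d d' : ℤ × ℤ, squareLattice.Adj d d' → p.1 + q.1 = d.1 + d'.1 + 1 →
      p.2 + q.2 = d.2 + d'.2 + 1 → p.1 - q.1 = d.2 - d'.2 → p.2 - q.2 = d'.1 - d.1 →
      ∃ d d', Crosses d d' p q := fun d d' h0 h1 h2 h3 h4 =>
    ⟨d, d', h0, Prod.ext h1 h2, h3, h4⟩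
  rw [squareLattice_adj_iff] at h
  rcases h with h | h | h | h
  · apply key (p + (0, -1)) p <;> simp [squareLattice_adj_iff] <;> grind
  · apply key (p + (-1, 0)) (p + (-1, -1)) <;> simp [squareLattice_adj_iff] <;> grind
  · apply key p (p + (-1, 0)) <;> simp [squareLattice_adj_iff] <;> grind
  · apply key (p + (-1, -1)) (p + (0, -1)) <;> simp [squareLattice_adj_iff] <;> grind

theorem Crosses.eq_of_crosses {d d' p q p' q' : ℤ × ℤ} (h : Crosses d d' p q)
    (h' : Crosses d d' p' q') : p = p' ∧ q = q' := by
  simp only [Crosses, Prod.ext_iff, Prod.fst_add, Prod.snd_add] at *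
  omega

theorem Bisects.eq_or_eq {d d' p q p' q' : ℤ × ℤ} (h : Bisects d d' p q)
    (h' : Bisects d d' p' q') : (p = p' ∧ q = q') ∨ (p = q' ∧ q = p') := by
  simp only [Bisects, squareLattice_adj_iff, Prod.ext_iff, Prod.fst_add, Prod.snd_add] at *
  omega

theorem Bisects.eq_or_eq_dual {d d' e e' p q : ℤ × ℤ} (h : Bisects d d' p q)
    (h' : Bisects e e' p q) : (d = e ∧ d' = e') ∨ (d = e' ∧ d' = e) := by
  simp only [Bisects, squareLattice_adj_iff, Prod.ext_iff, Prod.fst_add, Prod.snd_add] at *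
  obtain ⟨h | h | h | h, hp, h1, h2⟩ := h <;>
  obtain ⟨h' | h' | h' | h', -, h1', h2'⟩ := h' <;> omega

/-! ### Divergence-free flows and stream functions -/

theorem exists_sum_eq (h : ℤ → ℤ) : ∃ g : ℤ → ℤ, g 0 = 0 ∧ ∀ i, g (i + 1) - g i = h i := by
  refine ⟨fun i => ∑ k ∈ Finset.range i.toNat, h k -
    ∑ k ∈ Finset.range (-i).toNat, h (-((k : ℤ) + 1)), by simp, fun i => ?_⟩
  rcases i with n | n
  · have h1 : (Int.ofNat n + 1).toNat = n + 1 := by simp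
    have h2 : (-(Int.ofNat n + 1)).toNat = 0 := by simp
    have h3 : (-(Int.ofNat n)).toNat = 0 := by simp
    have h4 : (Int.ofNat n).toNat = n := by simp
    simp only [h1, h2, h3, h4, Finset.sum_range_succ]
    simp
  · have h1 : (Int.negSucc n + 1).toNat = 0 := by omega
    have h2 : (-(Int.negSucc n + 1)).toNat = n := by omega
    have h3 : (-(Int.negSucc n)).toNat = n + 1 := by omega
    have h4 : (Int.negSucc n).toNat = 0 := by omega
    simp only [h1, h2, h3, h4, Finset.sum_range_succ]
    simp [Int.negSucc_eq]

theorem int_const_of_succ {α : Type*} (f : ℤ → α) (h : ∀ i, f (i + 1) = f i) (i j : ℤ) :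
    f i = f j := by
  have key : ∀ i, f i = f 0 := fun i => by
    induction i using Int.induction_on with
    | zero => rfl
    | succ n ih => rw [h, ih]
    | pred n ih => rw [← ih, ← h (-(n : ℤ) - 1), sub_add_cancel]
  rw [key i, key j]

/-- The divergence at `d` of a flow `c` on the directed edges of the square lattice. -/
def divergence (c : ℤ × ℤ → ℤ × ℤ → ℤ) (d : ℤ × ℤ) : ℤ :=
  c d (d + (1, 0)) + c d (d + (-1, 0)) + c d (d + (0, 1)) + c d (d + (0, -1))

/-- A divergence-free flow on the square lattice has a stream function on the dual lattice. -/
theorem exists_stream (c : ℤ × ℤ → ℤ × ℤ → ℤ) (hc : ∀ d e, c d e = -c e d)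
    (hdiv : ∀ d, divergence c d = 0) :
    ∃ f : ℤ × ℤ → ℤ, ∀ d d' p q, Crosses d d' p q → f p - f q = c d d' := by
  set h : ℤ → ℤ → ℤ := fun x y => c (x, y) (x + 1, y) with hh
  set u : ℤ → ℤ → ℤ := fun x y => c (x, y) (x, y + 1) with hu
  have hd : ∀ x y, h x y - h (x - 1) y + u x y - u x (y - 1) = 0 := fun x y => by
    have := hdiv (x, y)
    simp only [divergence, Prod.mk_add_mk, add_zero] at this
    rw [hc (x, y) (x + -1, y), hc (x, y) (x, y + -1)] at this
    simp only [hh, hu, sub_add_cancel]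
    simp only [← sub_eq_add_neg] at this
    linarith
  -- The stream function is integrated along row 0 by `g` and then along each column by `G`.
  obtain ⟨g, -, hg⟩ := exists_sum_eq (fun x => -u x (-1))
  choose G hG0 hG using fun x => exists_sum_eq (fun y => h (x - 1) y)
  -- Horizontal increments are right on row 0 by the choice of `g`; zero divergence carries this to
  -- every row.
  have hx : ∀ x y, (g (x + 1) + G (x + 1) y) - (g x + G x y) = -u x (y - 1) := fun x y => by
    have := int_const_of_succ
      (fun y => (g (x + 1) + G (x + 1) y) - (g x + G x y) + u x (y - 1)) (fun y => by
        have h1 := hG (x + 1) y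
        have h2 := hG x y
        have h3 := hd x y
        simp only [add_sub_cancel_right] at *
        linarith) y 0
    have h0 := hg x
    simp only [hG0, zero_sub] at *
    linarith
  refine ⟨fun p => g p.1 + G p.1 p.2, fun d d' p q hcr => ?_⟩
  obtain ⟨a, b⟩ := d
  obtain ⟨a', b'⟩ := d'
  obtain ⟨p1, p2⟩ := p
  obtain ⟨q1, q2⟩ := q
  simp only [Crosses, squareLattice_adj_iff, Prod.ext_iff, Prod.fst_add, Prod.snd_add] at hcr
  obtain ⟨hadj, ⟨e1, e2⟩, e3, e4⟩ := hcr
  rcases hadj with ⟨r, s⟩ | ⟨r, s⟩ | ⟨r, s⟩ | ⟨r, s⟩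
  · obtain rfl : p1 = a + 1 := by omega
    obtain rfl : q1 = a + 1 := by omega
    obtain rfl : p2 = b + 1 := by omega
    obtain rfl : q2 = b := by omega
    subst r s
    have := hG (a + 1) b'
    simp only [add_sub_cancel_right] at this
    simp only [hh] at this
    linarith
  · obtain rfl : p1 = a := by omega
    obtain rfl : q1 = p1 := by omega
    obtain rfl : p2 = b := by omega
    obtain rfl : q2 = p2 + 1 := by omega
    subst r s
    have := hG q1 b'
    rw [hc]
    simp only [hh, sub_add_cancel] at *
    linarith
  · obtain rfl : p1 = a := by omega
    obtain rfl : q1 = p1 + 1 := by omega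
    obtain rfl : p2 = b + 1 := by omega
    obtain rfl : q2 = b + 1 := by omega
    subst r s
    have := hx a' (b + 1)
    simp only [hu, add_sub_cancel_right] at *
    linarith
  · obtain rfl : p1 = a + 1 := by omega
    obtain rfl : q1 = a := by omega
    obtain rfl : p2 = b := by omega
    obtain rfl : q2 = p2 := by omega
    subst r s
    have := hx a' q2
    rw [hc]
    simp only [hu, sub_add_cancel] at *
    linarith

/-- The unit flow along the directed edge from `a` to `b`. -/
def stepFlow (a b d e : ℤ × ℤ) : ℤ :=
  (if a = d ∧ b = e then 1 else 0) - (if a = e ∧ b = d then 1 else 0)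

theorem stepFlow_antisymm (a b d e : ℤ × ℤ) : stepFlow a b d e = -stepFlow a b e d := by
  simp only [stepFlow]; ring

theorem sum_neighbors_ite {d e : ℤ × ℤ} (h : squareLattice.Adj d e) :
    divergence (fun _ x => if e = x then 1 else 0) d = 1 := by
  simp only [squareLattice_adj_iff] at h
  simp only [divergence, Prod.ext_iff, Prod.fst_add, Prod.snd_add]
  rcases h with h | h | h | h <;> simp [h, ← sub_eq_add_neg] <;> grind

theorem divergence_stepFlow {a b : ℤ × ℤ} (h : squareLattice.Adj a b) (d : ℤ × ℤ) :
    divergence (stepFlow a b) d = (if a = d then 1 else 0) - (if b = d then 1 else 0) := by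
  have hab : a ≠ b := h.ne
  by_cases h1 : a = d
  · subst h1
    have := sum_neighbors_ite h
    simpa [divergence, stepFlow, hab.symm] using this
  · by_cases h2 : b = d
    · subst h2
      have := sum_neighbors_ite h.symm
      simp only [divergence] at this
      simp only [divergence, stepFlow, h1]
      simp
      linarith
    · simp [divergence, stepFlow, h1, h2]

theorem divergence_add (c c' : ℤ × ℤ → ℤ × ℤ → ℤ) (d : ℤ × ℤ) :
    divergence (fun a b => c a b + c' a b) d = divergence c d + divergence c' d := by
  simp only [divergence]; ring

theorem divergence_sum {ι : Type*} (s : Finset ι) (c : ι → ℤ × ℤ → ℤ × ℤ → ℤ) (d : ℤ × ℤ) :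
    divergence (fun a b => ∑ k ∈ s, c k a b) d = ∑ k ∈ s, divergence (c k) d := by
  simp only [divergence, Finset.sum_add_distrib]

/-! ### Existence of the boundary path -/

/-- A boundary edge continues, around the face at the end of its dual edge, to another boundary
edge whose inner endpoint is joined to the first one inside the face. -/
theorem exists_next {V : Set (ℤ × ℤ)} {d d' p q : ℤ × ℤ} (hp : p ∈ V) (hq : q ∉ V)
    (h : Bisects d d' p q) : ∃ e p' q', p' ∈ V ∧ q' ∉ V ∧ Bisects d' e p' q' ∧ e ≠ d ∧
      (p' = p ∨ squareLattice.Adj p p' ∨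
        ∃ r ∈ V, squareLattice.Adj p r ∧ squareLattice.Adj r p') ∧
      (Crosses d d' p q → Crosses d' e p' q') ∧ (Crosses d d' q p → Crosses d' e q' p') := by
  suffices H : ∃ e p' q', p' ∈ V ∧ q' ∉ V ∧ e ≠ d ∧
      (p' = p ∨ squareLattice.Adj p p' ∨
        ∃ r ∈ V, squareLattice.Adj p r ∧ squareLattice.Adj r p') ∧
      (Crosses d d' p q → Crosses d' e p' q') ∧ (Crosses d d' q p → Crosses d' e q' p') by
    obtain ⟨e, p', q', h1, h2, h3, h4, h5, h6⟩ := H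
    exact ⟨e, p', q', h1, h2,
      bisects_iff_crosses.2 ((bisects_iff_crosses.1 h).imp h5 h6), h3, h4, h5, h6⟩
  have hne : ∀ s : ℤ, s = 1 ∨ s = -1 → (d'.1 + s * (p.1 - q.1), d'.2 + s * (p.2 - q.2)) ≠ d := by
    intro s hs
    simp only [Bisects, squareLattice_adj_iff, Prod.ext_iff, Prod.fst_add, Prod.snd_add, ne_eq] at *
    obtain ⟨h, h', h1, h2⟩ := h
    rcases hs with rfl | rfl <;> rcases h with h | h | h | h <;> omega
  have hadj : squareLattice.Adj p (p + (d' - d)) := by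
    have := squareLattice_adj_iff.1 h.1
    simp only [squareLattice_adj_iff, Prod.fst_add, Prod.snd_add, Prod.fst_sub, Prod.snd_sub]
    omega
  -- The corners of the face at `d'` are `p`, `q` and their translates by `d' - d`. Membership of
  -- the translates decides between turning around `q`, going straight and turning around `p`.
  by_cases h1 : p + (d' - d) ∈ V
  · by_cases h2 : q + (d' - d) ∈ V
    · refine ⟨d' - (p - q), q + (d' - d), q, h2, hq, ?_, .inr (.inr ⟨_, h1, hadj, ?_⟩), ?_, ?_⟩
      · convert hne (-1) (.inr rfl) using 1
        ext <;> simp <;> ring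
      · have := squareLattice_adj_iff.1 h.2.1
        simp only [squareLattice_adj_iff, Prod.fst_add, Prod.snd_add, Prod.fst_sub, Prod.snd_sub]
        omega
      all_goals
        clear hne hadj h1 h2 h
        simp only [Crosses, squareLattice_adj_iff, Prod.ext_iff, Prod.fst_add,
          Prod.snd_add, Prod.fst_sub, Prod.snd_sub]
        rintro ⟨h | h | h | h, ⟨h1, h2⟩, h3, h4⟩ <;> refine ⟨?_, ⟨?_, ?_⟩, ?_, ?_⟩ <;> omega
    · refine ⟨d' + (d' - d), p + (d' - d), q + (d' - d), h1, h2, ?_, .inr (.inl hadj), ?_, ?_⟩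
      · have := squareLattice_adj_iff.1 h.1
        simp only [Prod.ext_iff, Prod.fst_add, Prod.snd_add, Prod.fst_sub, Prod.snd_sub, ne_eq]
        omega
      all_goals
        clear hne hadj h1 h2 h
        simp only [Crosses, squareLattice_adj_iff, Prod.ext_iff, Prod.fst_add,
          Prod.snd_add, Prod.fst_sub, Prod.snd_sub]
        rintro ⟨h | h | h | h, ⟨h1, h2⟩, h3, h4⟩ <;> refine ⟨?_, ⟨?_, ?_⟩, ?_, ?_⟩ <;> omega
  · refine ⟨d' + (p - q), p, p + (d' - d), hp, h1, ?_, .inl rfl, ?_, ?_⟩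
    · convert hne 1 (.inl rfl) using 1
      ext <;> simp
    all_goals
      clear hne hadj h1 h
      simp only [Crosses, squareLattice_adj_iff, Prod.ext_iff, Prod.fst_add,
        Prod.snd_add, Prod.fst_sub, Prod.snd_sub]
      rintro ⟨h | h | h | h, ⟨h1, h2⟩, h3, h4⟩ <;> refine ⟨?_, ⟨?_, ?_⟩, ?_, ?_⟩ <;> omega

theorem exists_bi_infinite {α : Type*} {R : α → α → Prop} {a b : α} (hab : R a b)
    (hnext : ∀ a b, R a b → ∃ c, R b c) (hprev : ∀ a b, R a b → ∃ c, R c a) :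
    ∃ w : ℤ → α, ∀ k, R (w k) (w (k + 1)) := by
  choose n hn using hnext
  choose m hm using hprev
  let N : {e : α × α // R e.1 e.2} → {e : α × α // R e.1 e.2} :=
    fun e => ⟨(e.1.2, n _ _ e.2), hn _ _ e.2⟩
  let M : {e : α × α // R e.1 e.2} → {e : α × α // R e.1 e.2} :=
    fun e => ⟨(m _ _ e.2, e.1.1), hm _ _ e.2⟩
  let e : {e : α × α // R e.1 e.2} := ⟨(a, b), hab⟩
  refine ⟨fun k => Int.casesOn k (fun i => (N^[i] e).1.1) (fun i => (M^[i + 1] e).1.1), ?_⟩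
  rintro (i | i)
  · change R (N^[i] e).1.1 (N^[i + 1] e).1.1
    rw [Function.iterate_succ_apply']
    exact (N^[i] e).2
  · have key : R (M^[i + 1] e).1.1 (M^[i] e).1.1 := by
      rw [Function.iterate_succ_apply']
      exact (M (M^[i] e)).2
    rcases i with - | i
    · exact key
    · exact key

/-- Sets that are invariant along the edges of a connected induced subgraph contain it. -/
theorem subset_of_connected {U S : Set (ℤ × ℤ)} (hU : (latticeOn U).Connected) {a : ℤ × ℤ}
    (ha : a ∈ U) (haS : a ∈ S)
    (hS : ∀ x ∈ S, ∀ y ∈ U, x ∈ U → squareLattice.Adj x y → y ∈ S) : U ⊆ S := by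
  intro b hb
  obtain ⟨γ⟩ := hU.preconnected ⟨a, ha⟩ ⟨b, hb⟩
  have key : ∀ {x y : U} (_ : (latticeOn U).Walk x y), x.1 ∈ S → y.1 ∈ S := by
    intro x y γ
    induction γ with
    | nil => exact id
    | cons h γ ih => exact fun hx => ih (hS _ hx _ (Subtype.mem _) (Subtype.mem _) h)
  exact key γ haS

theorem connected_of_forall_subset {U : Set (ℤ × ℤ)} {a : ℤ × ℤ} (ha : a ∈ U)
    (h : ∀ S : Set (ℤ × ℤ), a ∈ S →
      (∀ x ∈ S, ∀ y ∈ U, x ∈ U → squareLattice.Adj x y → y ∈ S) → U ⊆ S) :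
    (latticeOn U).Connected := by
  have key := h {x | ∃ hx : x ∈ U, (latticeOn U).Reachable ⟨a, ha⟩ ⟨x, hx⟩}
    ⟨ha, .rfl⟩ (fun x ⟨hx, hr⟩ y hy _ hxy =>
      ⟨hy, hr.trans (SimpleGraph.Adj.reachable (G := latticeOn U) (u := ⟨x, hx⟩) (v := ⟨y, hy⟩) hxy)⟩)
  have : Nonempty U := ⟨⟨a, ha⟩⟩
  refine ⟨fun x y => ?_⟩
  obtain ⟨_, hx⟩ := key x.2
  obtain ⟨_, hy⟩ := key y.2
  exact hx.symm.trans hy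

theorem eq_of_connected {α : Type*} {U : Set (ℤ × ℤ)} (hU : (latticeOn U).Connected)
    {f : ℤ × ℤ → α} (hf : ∀ x ∈ U, ∀ y ∈ U, squareLattice.Adj x y → f x = f y)
    {x y : ℤ × ℤ} (hx : x ∈ U) (hy : y ∈ U) : f x = f y :=
  (subset_of_connected (S := {z | f x = f z}) hU hx rfl
    (fun z hz t ht hzU hzt => Eq.trans hz (hf z hzU t ht hzt))) hy

/-- If a set and its complement are infinite, there are boundary edges outside every box. -/
theorem exists_boundary_edge {V : Set (ℤ × ℤ)} (hV : V.Infinite) (hVc : Vᶜ.Infinite) (N : ℤ) :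
    ∃ p ∈ V, ∃ q ∉ V, squareLattice.Adj p q ∧ (N < |p.1| ∨ N < |p.2|) := by
  by_contra hcon
  push Not at hcon
  set M : ℤ := max N 0 + 2 with hM
  have hstep : ∀ a b : ℤ × ℤ, squareLattice.Adj a b → (M ≤ |a.1| ∨ M ≤ |a.2|) →
      (b ∈ V) = (a ∈ V) := by
    intro a b hab ha
    have hab' := squareLattice_adj_iff.1 hab
    by_contra hne
    by_cases h : a ∈ V
    · have := hcon a h b (by simpa [h] using hne) hab
      grind
    · have := hcon b (by simpa [h] using hne) a h hab.symm
      grind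
  -- Every point outside the box reaches `(M, M)` along far rows and columns, so all such points lie
  -- on the same side.
  have hcol : ∀ a b b' : ℤ, M ≤ |a| → (((a, b) : ℤ × ℤ) ∈ V) = ((a, b') ∈ V) := fun a b b' ha =>
    int_const_of_succ (fun b => ((a, b) : ℤ × ℤ) ∈ V)
      (fun i => hstep (a, i) (a, i + 1) (by simp [squareLattice_adj_iff]) (.inl ha)) b b'
  have hrow : ∀ a a' b : ℤ, M ≤ |b| → (((a, b) : ℤ × ℤ) ∈ V) = ((a', b) ∈ V) := fun a a' b hb =>
    int_const_of_succ (fun a => ((a, b) : ℤ × ℤ) ∈ V)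
      (fun i => hstep (i, b) (i + 1, b) (by simp [squareLattice_adj_iff]) (.inr hb)) a a'
  have hMM : M ≤ |M| := le_abs_self M
  have hall : ∀ a : ℤ × ℤ, (M ≤ |a.1| ∨ M ≤ |a.2|) → (a ∈ V) = ((M, M) ∈ V) := by
    rintro ⟨a, b⟩ (h | h)
    · rw [hcol a b M h, hrow a M M hMM]
    · rw [hrow a M b h, hcol M b M hMM]
  have hbox : (Set.Icc (-M) M ×ˢ Set.Icc (-M) M : Set (ℤ × ℤ)).Finite :=
    (Set.finite_Icc _ _).prod (Set.finite_Icc _ _)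
  have hin : ∀ a : ℤ × ℤ, ¬(M ≤ |a.1| ∨ M ≤ |a.2|) →
      a ∈ (Set.Icc (-M) M ×ˢ Set.Icc (-M) M : Set (ℤ × ℤ)) := by
    intro a ha
    simp only [Set.mem_prod, Set.mem_Icc]
    grind
  by_cases hc : (M, M) ∈ V
  · exact hVc (hbox.subset fun a ha => hin a fun h => ha (by rw [hall a h]; exact hc))
  · exact hV (hbox.subset fun a ha => hin a fun h => hc (by rw [← hall a h]; exact ha))

theorem exists_boundary_edge_notMem {V : Set (ℤ × ℤ)} (hV : V.Infinite) (hVc : Vᶜ.Infinite)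
    {T : Set (ℤ × ℤ)} (hT : T.Finite) :
    ∃ d d' p q, p ∈ V ∧ q ∉ V ∧ Crosses d d' p q ∧ d ∉ T := by
  obtain ⟨B, hB⟩ := (hT.image (fun p : ℤ × ℤ => |p.1| + |p.2|)).bddAbove
  obtain ⟨p, hp, q, hq, hpq, hout⟩ := exists_boundary_edge hV hVc (B + 1)
  obtain ⟨d, d', hc⟩ := exists_crosses hpq
  refine ⟨d, d', p, q, hp, hq, hc, fun hd => ?_⟩
  have h1 : |d.1| + |d.2| ≤ B := hB ⟨d, hd, rfl⟩
  simp only [Crosses, squareLattice_adj_iff, Prod.ext_iff, Prod.fst_add, Prod.snd_add] at hc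
  grind

/-- A dual step with `V` on its left and the complement of `V` on its right. -/
def LeftStep (V : Set (ℤ × ℤ)) (d d' : ℤ × ℤ) : Prop :=
  ∃ p q, p ∈ V ∧ q ∉ V ∧ Crosses d d' p q

theorem LeftStep.adj {V : Set (ℤ × ℤ)} {d d' : ℤ × ℤ} (h : LeftStep V d d') :
    squareLattice.Adj d d' := by
  obtain ⟨p, q, -, -, h⟩ := h
  exact h.1

theorem LeftStep.mem {V : Set (ℤ × ℤ)} {d d' p q : ℤ × ℤ} (h : LeftStep V d d')
    (hc : Crosses d d' p q) : p ∈ V ∧ q ∉ V := by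
  obtain ⟨p', q', hp, hq, h⟩ := h
  obtain ⟨rfl, rfl⟩ := h.eq_of_crosses hc
  exact ⟨hp, hq⟩

theorem LeftStep.exists_next {V : Set (ℤ × ℤ)} {d d' : ℤ × ℤ} (h : LeftStep V d d') :
    ∃ e, LeftStep V d' e := by
  obtain ⟨p, q, hp, hq, h⟩ := h
  obtain ⟨e, p', q', hp', hq', -, -, -, hc, -⟩ := _root_.exists_next hp hq h.bisects
  exact ⟨e, p', q', hp', hq', hc h⟩

theorem LeftStep.exists_prev {V : Set (ℤ × ℤ)} {d d' : ℤ × ℤ} (h : LeftStep V d d') :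
    ∃ e, LeftStep V e d := by
  obtain ⟨p, q, hp, hq, h⟩ := h
  obtain ⟨e, p', q', hp', hq', -, -, -, -, hc⟩ :=
    _root_.exists_next hp hq h.bisects.reverse
  exact ⟨e, p', q', hp', hq', (hc h.reverse).reverse⟩

/-- A divergence-free flow supported on the boundary of `V` is constant along the boundary. -/
theorem flow_const_of_connected {V : Set (ℤ × ℤ)} (hV : (latticeOn V).Connected)
    (hVc : (latticeOn Vᶜ).Connected) {c : ℤ × ℤ → ℤ × ℤ → ℤ} (hc : ∀ d e, c d e = -c e d)
    (hdiv : ∀ d, divergence c d = 0)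
    (hsupp : ∀ d d', ¬ LeftStep V d d' → ¬ LeftStep V d' d → c d d' = 0)
    {d d' e e' : ℤ × ℤ} (hd : LeftStep V d d') (he : LeftStep V e e') : c d d' = c e e' := by
  obtain ⟨f, hf⟩ := exists_stream c hc hdiv
  -- The stream function jumps only across boundary edges. It is thus constant on `V` and on `Vᶜ`,
  -- and the flow along every left step is the difference of the two constants.
  have key : ∀ x y, squareLattice.Adj x y → (x ∈ V ↔ y ∈ V) → f x = f y := by
    intro x y hxy hiff
    obtain ⟨a, a', ha⟩ := exists_crosses hxy
    have h1 := hf _ _ _ _ ha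
    rw [hsupp a a' (fun h => (h.mem ha).2 (hiff.1 (h.mem ha).1))
      (fun h => (h.mem ha.reverse).2 (hiff.2 (h.mem ha.reverse).1))] at h1
    linarith
  obtain ⟨p, q, hp, hq, hpq⟩ := hd
  obtain ⟨r, s, hr, hs, hrs⟩ := he
  rw [← hf _ _ _ _ hpq, ← hf _ _ _ _ hrs,
    eq_of_connected hV (fun x hx y hy h => key x y h (by simp [hx, hy])) hp hr,
    eq_of_connected hVc (fun x hx y hy h => key x y h (by
      simp only [Set.mem_compl_iff] at hx hy; simp [hx, hy])) hq hs]

/-- A repeated vertex would close a loop, whose unit flow is divergence-free with finite support. By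
`flow_const_of_connected` it has one value on all left steps, yet it vanishes on a far one and is
positive on the loop. -/
theorem leftStep_injective {V : Set (ℤ × ℤ)} (hV : V.Infinite) (hVconn : (latticeOn V).Connected)
    (hVc : Vᶜ.Infinite) (hVcconn : (latticeOn Vᶜ).Connected) {w : ℤ → ℤ × ℤ}
    (hw : ∀ k, LeftStep V (w k) (w (k + 1))) : Function.Injective w := by
  have key : ∀ i j, i < j → w i ≠ w j := by
    intro i j hij heq
    set c : ℤ × ℤ → ℤ × ℤ → ℤ := fun d e =>
      ∑ k ∈ Finset.range (j - i).toNat, stepFlow (w (i + k)) (w (i + k + 1)) d e with hcdef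
    have hanti : ∀ d e, c d e = -c e d := fun d e => by
      simp only [hcdef]
      rw [← Finset.sum_neg_distrib]
      exact Finset.sum_congr rfl fun k _ => stepFlow_antisymm _ _ _ _
    have hdiv : ∀ d, divergence c d = 0 := fun d => by
      rw [hcdef, divergence_sum]
      simp only [divergence_stepFlow (hw _).adj]
      have := Finset.sum_range_sub' (fun k : ℕ => if w (i + k) = d then (1 : ℤ) else 0)
        (j - i).toNat
      push_cast at this
      simp only [← add_assoc] at this
      rw [this, Int.toNat_of_nonneg (by omega)]
      simp [heq]
    -- No cancellation occurs on left steps: there the flow counts passages of the path.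
    have hval : ∀ d d', ¬ LeftStep V d' d → c d d' =
        ∑ k ∈ Finset.range (j - i).toNat,
          if w (i + k) = d ∧ w (i + k + 1) = d' then 1 else 0 := fun d d' h => by
      refine Finset.sum_congr rfl fun k _ => ?_
      rw [stepFlow, if_neg (c := _ ∧ w (i + k + 1) = d), sub_zero]
      rintro ⟨rfl, rfl⟩
      exact h (hw _)
    have hasymm : ∀ d d', LeftStep V d d' → ¬ LeftStep V d' d := by
      rintro d d' ⟨p, q, hp, hq, h⟩ h'
      exact hq (h'.mem h.reverse).1
    have hsupp : ∀ d d', ¬ LeftStep V d d' → ¬ LeftStep V d' d → c d d' = 0 := by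
      intro d d' h h'
      rw [hval d d' h']
      refine Finset.sum_eq_zero fun k _ => if_neg ?_
      rintro ⟨rfl, rfl⟩
      exact h (hw _)
    obtain ⟨d, d', p, q, hp, hq, hcr, hd⟩ := exists_boundary_edge_notMem hV hVc
      ((Finset.range (j - i).toNat).image (fun k : ℕ => w (i + k))).finite_toSet
    have hstep : LeftStep V d d' := ⟨p, q, hp, hq, hcr⟩
    have h0 : c d d' = 0 := by
      rw [hval d d' (hasymm _ _ hstep)]
      refine Finset.sum_eq_zero fun k hk => if_neg ?_
      rintro ⟨rfl, rfl⟩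
      exact hd (Finset.mem_coe.2 (Finset.mem_image_of_mem _ hk))
    have h1 := flow_const_of_connected hVconn hVcconn hanti hdiv hsupp hstep (hw i)
    rw [h0, hval _ _ (hasymm _ _ (hw i))] at h1
    have h2 := Finset.single_le_sum (f := fun k : ℕ =>
      if w (i + k) = w i ∧ w (i + k + 1) = w (i + 1) then (1 : ℤ) else 0)
      (fun k _ => by positivity) (Finset.mem_range.2 (show 0 < (j - i).toNat by omega))
    rw [← h1] at h2
    simp at h2
  intro i j h
  rcases lt_trichotomy i j with h' | h' | h'
  · exact absurd h (key _ _ h')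
  · exact h'
  · exact absurd h.symm (key _ _ h')

-- By injectivity each visited vertex has one incoming and one outgoing step, so the unit flow along
-- the whole path is divergence-free. Having value 1 on one left step, it has value 1 on all of
-- them.
open Classical in
theorem leftStep_exhausts {V : Set (ℤ × ℤ)} (hVconn : (latticeOn V).Connected)
    (hVcconn : (latticeOn Vᶜ).Connected) {w : ℤ → ℤ × ℤ} (hinj : Function.Injective w)
    (hw : ∀ k, LeftStep V (w k) (w (k + 1))) {d d' : ℤ × ℤ} (hd : LeftStep V d d') :
    ∃ k, w k = d ∧ w (k + 1) = d' := by
  set c : ℤ × ℤ → ℤ × ℤ → ℤ := fun d e =>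
    (if ∃ k, w k = d ∧ w (k + 1) = e then 1 else 0) -
      (if ∃ k, w k = e ∧ w (k + 1) = d then 1 else 0) with hcdef
  have hanti : ∀ d e, c d e = -c e d := fun d e => by simp only [hcdef]; ring
  have hdiv : ∀ d, divergence c d = 0 := fun d => by
    by_cases hk : ∃ k, w k = d
    · obtain ⟨k, rfl⟩ := hk
      have h1 : ∀ e, (∃ l, w l = w k ∧ w (l + 1) = e) ↔ w (k + 1) = e := fun e =>
        ⟨fun ⟨l, hl, hl'⟩ => hinj hl ▸ hl', fun h => ⟨k, rfl, h⟩⟩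
      have h2 : ∀ e, (∃ l, w l = e ∧ w (l + 1) = w k) ↔ w (k - 1) = e := fun e =>
        ⟨fun ⟨l, hl, hl'⟩ => by rw [← hl, ← hinj hl', add_sub_cancel_right],
          fun h => ⟨k - 1, h, by rw [sub_add_cancel]⟩⟩
      have h3 := sum_neighbors_ite (hw k).adj
      have h4 := sum_neighbors_ite (d := w k) (e := w (k - 1)) (by
        have := (hw (k - 1)).adj.symm
        rwa [sub_add_cancel] at this)
      simp only [divergence] at h3 h4
      simp only [divergence, hcdef, h1, h2]
      linarith
    · have h1 : ∀ e, ¬ ∃ l, w l = d ∧ w (l + 1) = e := fun e ⟨l, hl, _⟩ => hk ⟨l, hl⟩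
      have h2 : ∀ e, ¬ ∃ l, w l = e ∧ w (l + 1) = d := fun e ⟨l, _, hl⟩ => hk ⟨_, hl⟩
      simp only [divergence, hcdef, h1, h2]
      simp
  have hsupp : ∀ d d', ¬ LeftStep V d d' → ¬ LeftStep V d' d → c d d' = 0 := by
    intro d d' h h'
    simp only [hcdef]
    rw [if_neg (fun ⟨k, h1, h2⟩ => h (h1 ▸ h2 ▸ hw k)),
      if_neg (fun ⟨k, h1, h2⟩ => h' (h1 ▸ h2 ▸ hw k)), sub_zero]
  have hasymm : ∀ d d', LeftStep V d d' → ¬ LeftStep V d' d := by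
    rintro d d' ⟨p, q, hp, hq, h⟩ h'
    exact hq (h'.mem h.reverse).1
  have hval : ∀ d d', LeftStep V d d' →
      c d d' = if ∃ k, w k = d ∧ w (k + 1) = d' then 1 else 0 := fun d d' h => by
    simp only [hcdef]
    rw [if_neg (c := ∃ k, w k = d' ∧ w (k + 1) = d), sub_zero]
    exact fun ⟨k, h1, h2⟩ => hasymm _ _ h (h1 ▸ h2 ▸ hw k)
  have h1 := flow_const_of_connected hVconn hVcconn hanti hdiv hsupp hd (hw 0)
  rw [hval _ _ hd, hval _ _ (hw 0), if_pos (c := ∃ k, w k = w 0 ∧ w (k + 1) = w (0 + 1)) ⟨0, rfl, rfl⟩] at h1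
  by_contra h
  simp [h] at h1

theorem exists_isBoundaryPath {V : Set (ℤ × ℤ)} (hV : V.Infinite)
    (hVconn : (latticeOn V).Connected) (hVc : Vᶜ.Infinite)
    (hVcconn : (latticeOn Vᶜ).Connected) :
    ∃ (w : ℤ → ℤ × ℤ) (v : ℤ → V), IsBoundaryPath V w v := by
  obtain ⟨d, d', p, q, hp, hq, hcr, -⟩ := exists_boundary_edge_notMem hV hVc Set.finite_empty
  obtain ⟨w, hw⟩ := exists_bi_infinite (R := LeftStep V) ⟨p, q, hp, hq, hcr⟩
    (fun _ _ h => h.exists_next) (fun _ _ h => h.exists_prev)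
  have hinj := leftStep_injective hV hVconn hVc hVcconn hw
  have hw' := hw
  choose v q hv hq hc using hw'
  refine ⟨w, fun k => ⟨v k, hv k⟩, hinj, fun k => ⟨q k, hq k, (hc k).bisects⟩,
    fun p q hp hq hpq => ?_⟩
  obtain ⟨d, d', h⟩ := exists_crosses hpq
  obtain ⟨k, rfl, rfl⟩ := leftStep_exhausts hVconn hVcconn hinj hw ⟨p, q, hp, hq, h⟩
  exact ⟨k, h.bisects⟩

/-! ### Walks between interlacing boundary points meet -/

/-- The unit flow along a walk in an induced subgraph of the square lattice. -/
def walkFlow {U : Set (ℤ × ℤ)} : {x y : U} → (latticeOn U).Walk x y → ℤ × ℤ → ℤ × ℤ → ℤ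
  | _, _, .nil, _, _ => 0
  | x, _, .cons (v := z) _ γ, d, e => stepFlow x z d e + walkFlow γ d e

theorem walkFlow_antisymm {U : Set (ℤ × ℤ)} {x y : U} (γ : (latticeOn U).Walk x y)
    (d e : ℤ × ℤ) : walkFlow γ d e = -walkFlow γ e d := by
  induction γ with
  | nil => rfl
  | cons h γ ih => rw [walkFlow, walkFlow, stepFlow_antisymm, ih, neg_add]

theorem divergence_walkFlow {U : Set (ℤ × ℤ)} {x y : U} (γ : (latticeOn U).Walk x y)
    (d : ℤ × ℤ) : divergence (walkFlow γ) d =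
      (if x.1 = d then 1 else 0) - (if y.1 = d then 1 else 0) := by
  induction γ with
  | nil => simp [divergence, walkFlow]
  | @cons a b _ h γ ih =>
    have h1 := divergence_add (stepFlow a b) (walkFlow γ) d
    rw [divergence_stepFlow (show squareLattice.Adj a.1 b.1 from h), ih] at h1
    rw [show walkFlow (.cons h γ) = fun d e => stepFlow a b d e + walkFlow γ d e from rfl, h1]
    ring

theorem walkFlow_eq_zero {U : Set (ℤ × ℤ)} {x y : U} (γ : (latticeOn U).Walk x y)
    {d e : ℤ × ℤ} (h : ∀ z ∈ γ.support, z.1 ≠ e) : walkFlow γ d e = 0 := by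
  induction γ with
  | nil => rfl
  | cons hxy γ ih =>
    rw [walkFlow, ih fun z hz => h z (by simp [hz]), add_zero, stepFlow]
    have h1 := h _ (SimpleGraph.Walk.start_mem_support _)
    have h2 := h _ (List.mem_cons_of_mem _ γ.start_mem_support)
    rw [if_neg (fun hh => h2 hh.2), if_neg (fun hh => h1 hh.1), sub_zero]

theorem walkFlow_eq_zero_of_notMem {U : Set (ℤ × ℤ)} {x y : U} (γ : (latticeOn U).Walk x y)
    {d e : ℤ × ℤ} (h : e ∉ U) : walkFlow γ d e = 0 :=
  walkFlow_eq_zero γ fun z _ hz => h (hz ▸ z.2)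

namespace IsBoundaryPath

variable {V : Set (ℤ × ℤ)} {w : ℤ → ℤ × ℤ} {v : ℤ → V}

theorem reverse (h : IsBoundaryPath V w v) :
    IsBoundaryPath V (fun i => w (-i)) (fun i => v (-i - 1)) where
  selfAvoiding := h.selfAvoiding.comp neg_injective
  crosses i := by
    obtain ⟨q, hq, hb⟩ := h.crosses (-i - 1)
    refine ⟨q, hq, ?_⟩
    rw [sub_add_cancel] at hb
    rw [neg_add, ← sub_eq_add_neg]
    exact hb.reverse
  exhausts p q hp hq hpq := by
    obtain ⟨i, hi⟩ := h.exhausts p q hp hq hpq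
    refine ⟨-i - 1, ?_⟩
    rw [show -(-i - 1) = i + 1 by ring, show -(-i - 1 + 1) = i by ring]
    exact hi.reverse

/-- Distinct steps of the boundary path bisect distinct edges. -/
theorem index_unique (h : IsBoundaryPath V w v) {i j : ℤ} {p q : ℤ × ℤ}
    (hi : Bisects (w i) (w (i + 1)) p q) (hj : Bisects (w j) (w (j + 1)) p q) : i = j := by
  rcases hi.eq_or_eq_dual hj with ⟨h1, -⟩ | ⟨h1, h2⟩
  · exact h.selfAvoiding h1
  · have := h.selfAvoiding h1
    have := h.selfAvoiding h2
    omega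

/-- Two walks in `V` between interlacing points of the boundary path meet. -/
theorem exists_mem_support (h : IsBoundaryPath V w v) (hVc : (latticeOn Vᶜ).Connected)
    {i j n m : ℤ} (hij : i ≤ j) (hjn : j ≤ n) (hnm : n ≤ m)
    (γ : (latticeOn V).Walk (v i) (v n)) (γ' : (latticeOn V).Walk (v j) (v m)) :
    ∃ z, z ∈ γ.support ∧ z ∈ γ'.support := by
  by_contra hdisj
  push Not at hdisj
  have hij : i < j := lt_of_le_of_ne hij fun hh => hdisj (v i) (by simp) (by simp [hh])
  have hjn : j < n := lt_of_le_of_ne hjn fun hh => hdisj (v j) (by simp [hh]) (by simp)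
  have hnm : n < m := lt_of_le_of_ne hnm fun hh => hdisj (v n) (by simp) (by simp [hh])
  have hcr := h.crosses
  choose q hq hb using hcr
  -- The walk `γ` is closed to a loop through the complement of `V`; this loop crosses the boundary
  -- path only at steps `n` (outward) and `i` (inward).
  obtain ⟨β⟩ := hVc.preconnected ⟨q n, hq n⟩ ⟨q i, hq i⟩
  set c : ℤ × ℤ → ℤ × ℤ → ℤ := fun d e =>
    ((walkFlow γ d e + stepFlow (v n) (q n) d e) + walkFlow β d e) + stepFlow (q i) (v i) d e
    with hcdef
  have hanti : ∀ d e, c d e = -c e d := fun d e => by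
    simp only [hcdef]
    rw [walkFlow_antisymm γ, walkFlow_antisymm β, stepFlow_antisymm _ (q n),
      stepFlow_antisymm (q i)]
    ring
  have hdiv : ∀ d, divergence c d = 0 := fun d => by
    rw [hcdef, divergence_add, divergence_add, divergence_add, divergence_walkFlow,
      divergence_walkFlow, divergence_stepFlow (hb n).2.1, divergence_stepFlow (hb i).2.1.symm]
    ring
  obtain ⟨f, hf⟩ := exists_stream c hanti hdiv
  have hmem : ∀ k l, (v k).1 ≠ q l := fun k l hh => hq l (hh ▸ (v k).2)
  have hval : ∀ k, c (v k) (q k) = (if k = n then 1 else 0) - (if k = i then 1 else 0) := by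
    intro k
    have h1 : walkFlow γ (v k) (q k) = 0 := walkFlow_eq_zero_of_notMem γ (hq k)
    have h2 : walkFlow β (v k) (q k) = 0 := by
      rw [walkFlow_antisymm, walkFlow_eq_zero_of_notMem β (fun hh => hh (v k).2), neg_zero]
    have h3 : ∀ l, ((v l).1 = v k ∧ q l = q k) ↔ k = l := by
      refine fun l => ⟨fun ⟨e1, e2⟩ => h.index_unique (hb k) ?_, fun e => by rw [e]; simp⟩
      rw [← e1, ← e2]
      exact hb l
    have h4 : ∀ l, (q l = q k ∧ (v l).1 = v k) ↔ k = l := fun l => and_comm.trans (h3 l)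
    have h5 : ∀ l, q l ≠ (v k).1 := fun l => (hmem k l).symm
    simp only [hcdef, h1, h2, stepFlow, h3, h4, h5, false_and, hmem, if_false]
    ring
  -- The flow now lives on the lattice itself, so `f a` sits at the point `a - (1/2, 1/2)`, and the
  -- dual vertex named `d` is read at `d + (1, 1)`.
  set F : ℤ × ℤ → ℤ := fun d => f (d + (1, 1)) with hF
  have hstep : ∀ k, k ≠ i → k ≠ n → F (w (k + 1)) = F (w k) := by
    intro k h1 h2
    have h3 := hval k
    rw [if_neg h2, if_neg h1, sub_zero] at h3
    rcases bisects_iff_crosses.1 (hb k) with hc | hc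
    · have := hf _ _ _ _ hc.swap
      rw [hanti, h3] at this
      simp only [hF]; linarith
    · have := hf _ _ _ _ hc.swap
      rw [h3] at this
      simp only [hF]; linarith
  have hstep_n : F (w (n + 1)) ≠ F (w n) := by
    have h3 := hval n
    rw [if_pos rfl, if_neg (by omega), sub_zero] at h3
    rcases bisects_iff_crosses.1 (hb n) with hc | hc
    · have := hf _ _ _ _ hc.swap
      rw [hanti, h3] at this
      simp only [hF]; omega
    · have := hf _ _ _ _ hc.swap
      rw [h3] at this
      simp only [hF]; omega
  have hbetween : ∀ (t : ℕ) (a : ℤ), (∀ k, a ≤ k → k < a + t → k ≠ i ∧ k ≠ n) →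
      F (w (a + t)) = F (w a) := by
    intro t a
    induction t with
    | zero => simp
    | succ t ih =>
      intro hk
      have h1 := hk (a + t) (by omega) (by push_cast; omega)
      have h2 := hstep _ h1.1 h1.2
      push_cast
      rw [← add_assoc, h2, ih fun k h1 h2 => hk k h1 (by push_cast; omega)]
  have hjn' : F (w n) = F (w j) := by
    have := hbetween (n - j).toNat j (fun k h1 h2 => by omega)
    rwa [Int.toNat_of_nonneg (by omega), add_sub_cancel] at this
  have hnm' : F (w m) = F (w (n + 1)) := by
    have := hbetween (m - (n + 1)).toNat (n + 1) (fun k h1 h2 => by omega)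
    rwa [Int.toNat_of_nonneg (by omega), add_sub_cancel] at this
  -- The loop avoids `γ'`, so `f` agrees on the four faces around each vertex of `γ'` and is
  -- constant along `γ'`. This forces `F (w j) = F (w m)`, against the jump of `F` across step `n`.
  have hout : ∀ z ∈ γ'.support, ∀ e, c e z = 0 := by
    intro z hz e
    have hzq : ∀ k, q k ≠ z := fun k hh => hq k (hh ▸ z.2)
    have h1 : walkFlow γ e z = 0 := walkFlow_eq_zero γ fun y hy hyz =>
      hdisj y hy (Subtype.ext hyz ▸ hz)
    have h2 : walkFlow β e z = 0 := walkFlow_eq_zero_of_notMem β (fun hh => hh z.2)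
    have h3 : (v n).1 ≠ z := fun hh => hdisj z (Subtype.ext hh ▸ by simp) hz
    have h4 : (v i).1 ≠ z := fun hh => hdisj z (Subtype.ext hh ▸ by simp) hz
    simp [hcdef, h1, h2, h3, h4, stepFlow, hzq]
  have hface : ∀ z ∈ γ'.support, ∀ a : ℤ × ℤ, (a = (0, 0) ∨ a = (1, 0) ∨ a = (0, 1) ∨ a = (1, 1)) →
      f (z.1 + a) = f z := by
    intro z hz a ha
    have key : ∀ d a b, Crosses d z b a → f a = f b := fun d a b hc => by
      have := hf _ _ _ _ hc
      rw [hout z hz] at this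
      linarith
    have e1 : f z.1 = f (z.1 + (0, 1)) := key (z.1 + (-1, 0)) _ _ (by
      simp only [Crosses, squareLattice_adj_iff, Prod.ext_iff, Prod.fst_add, Prod.snd_add]
      omega)
    have e2 : f (z.1 + (1, 0)) = f z.1 := key (z.1 + (0, -1)) _ _ (by
      simp only [Crosses, squareLattice_adj_iff, Prod.ext_iff, Prod.fst_add, Prod.snd_add]
      omega)
    have e3 : f (z.1 + (1, 1)) = f (z.1 + (1, 0)) := key (z.1 + (1, 0)) _ _ (by
      simp only [Crosses, squareLattice_adj_iff, Prod.ext_iff, Prod.fst_add, Prod.snd_add]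
      omega)
    rcases ha with rfl | rfl | rfl | rfl
    · rw [show z.1 + (0, 0) = z.1 from add_zero _]
    · exact e2
    · exact e1.symm
    · exact e3.trans e2
  have hwalk : ∀ {x y : V} (α : (latticeOn V).Walk x y),
      (∀ z ∈ α.support, z ∈ γ'.support) → f x = f y := by
    intro x y α
    induction α with
    | nil => exact fun _ => rfl
    | @cons a b _ hab α ih =>
      intro hs
      refine Eq.trans ?_ (ih fun z hz => hs z (by simp [hz]))
      have ha := hface a (hs a (by simp))
      have hb := hface b (hs b (by simp))
      have hab' : squareLattice.Adj a.1 b.1 := hab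
      rw [squareLattice_adj_iff] at hab'
      rcases hab' with hh | hh | hh | hh
      · rw [← ha (1, 0) (by simp), show b.1 = a.1 + (1, 0) from Prod.ext hh.1 (by simpa using hh.2)]
      · rw [← hb (1, 0) (by simp), show a.1 = b.1 + (1, 0) from
          Prod.ext (by simp [hh.1]) (by simp [hh.2])]
      · rw [← ha (0, 1) (by simp), show b.1 = a.1 + (0, 1) from Prod.ext (by simpa using hh.1) hh.2]
      · rw [← hb (0, 1) (by simp), show a.1 = b.1 + (0, 1) from
          Prod.ext (by simp [hh.1]) (by simp [hh.2])]
  have hcorner : ∀ k, v k ∈ γ'.support → F (w k) = f (v k) := by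
    intro k hk
    obtain ⟨a, ha, hak⟩ : ∃ a : ℤ × ℤ, (a = (0, 0) ∨ a = (1, 0) ∨ a = (0, 1) ∨ a = (1, 1)) ∧
        w k + (1, 1) = (v k).1 + a := by
      refine ⟨w k + (1, 1) - (v k).1, ?_, by abel⟩
      have := hb k
      simp only [Bisects, squareLattice_adj_iff, Prod.ext_iff, Prod.fst_add, Prod.snd_add,
        Prod.fst_sub, Prod.snd_sub] at this ⊢
      omega
    simp only [hF]
    rw [hak, hface _ hk a ha]
  have h1 := hcorner j (by simp)
  have h2 := hcorner m (by simp)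
  have h3 := hwalk γ' (fun _ => id)
  exact hstep_n (by rw [← hnm', hjn', h1, h2, h3])

end IsBoundaryPath

/-! ### Elementary properties of passage times -/

section PassageTime

variable {V : Set (ℤ × ℤ)} (ω : Configuration V)

theorem pathTime_nonneg {x y : V} (γ : (latticeOn V).Walk x y) : 0 ≤ pathTime ω γ := by
  induction γ with
  | nil => exact le_rfl
  | cons h γ ih => exact add_nonneg (NNReal.coe_nonneg _) ih

theorem pathTime_append {x y z : V} (γ : (latticeOn V).Walk x y) (γ' : (latticeOn V).Walk y z) :
    pathTime ω (γ.append γ') = pathTime ω γ + pathTime ω γ' := by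
  induction γ with
  | nil => exact (zero_add _).symm
  | cons h γ ih =>
    rw [SimpleGraph.Walk.cons_append, pathTime, pathTime, ih, add_assoc]

theorem passageTime_le {x y : V} (γ : (latticeOn V).Walk x y) :
    passageTime ω x y ≤ pathTime ω γ :=
  ciInf_le ⟨0, by rintro _ ⟨γ, rfl⟩; exact pathTime_nonneg ω γ⟩ γ

theorem passageTime_nonneg (x y : V) : 0 ≤ passageTime ω x y :=
  Real.iInf_nonneg fun γ => pathTime_nonneg ω γ

theorem passageTime_self (x : V) : passageTime ω x x = 0 :=
  le_antisymm (passageTime_le ω .nil) (passageTime_nonneg ω x x)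

variable {ω}

theorem le_passageTime (hV : (latticeOn V).Connected) {x y : V} {a : ℝ}
    (h : ∀ γ : (latticeOn V).Walk x y, a ≤ pathTime ω γ) : a ≤ passageTime ω x y :=
  have : Nonempty ((latticeOn V).Walk x y) := hV.preconnected x y
  le_ciInf h

theorem passageTime_triangle (hV : (latticeOn V).Connected) (x y z : V) :
    passageTime ω x z ≤ passageTime ω x y + passageTime ω y z := by
  rw [← sub_le_iff_le_add]
  refine le_passageTime hV fun γ => ?_
  rw [sub_le_iff_le_add, ← sub_le_iff_le_add']
  refine le_passageTime hV fun γ' => ?_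
  rw [sub_le_iff_le_add', ← pathTime_append]
  exact passageTime_le ω _

theorem passageTime_le_edge (hV : (latticeOn V).Connected) {x y : V}
    (h : (latticeOn V).Adj x y) (z : V) :
    passageTime ω x z ≤ ω ⟨s(x, y), h⟩ + passageTime ω y z := by
  rw [← sub_le_iff_le_add']
  refine le_passageTime hV fun γ => ?_
  rw [sub_le_iff_le_add']
  exact passageTime_le ω (.cons h γ)

end PassageTime

/-! ### Monotonicity and convergence on the boundary -/

namespace IsBoundaryPath

variable {V : Set (ℤ × ℤ)} {w : ℤ → ℤ × ℤ} {v : ℤ → V}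

/-- The two walks share a vertex; swapping their tails there preserves the total passage time and
exchanges the endpoints. -/
theorem passageTime_exchange (h : IsBoundaryPath V w v) (hV : (latticeOn V).Connected)
    (hVc : (latticeOn Vᶜ).Connected) (ω : Configuration V) {i j n m : ℤ} (hij : i ≤ j)
    (hjn : j ≤ n) (hnm : n ≤ m) :
    passageTime ω (v i) (v m) + passageTime ω (v j) (v n) ≤
      passageTime ω (v i) (v n) + passageTime ω (v j) (v m) := by
  classical
  rw [← sub_le_iff_le_add]
  refine le_passageTime hV fun γ => ?_
  rw [sub_le_iff_le_add, ← sub_le_iff_le_add']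
  refine le_passageTime hV fun γ' => ?_
  rw [sub_le_iff_le_add']
  obtain ⟨z, hz, hz'⟩ := h.exists_mem_support hVc hij hjn hnm γ γ'
  have h1 := passageTime_le ω ((γ.takeUntil z hz).append (γ'.dropUntil z hz'))
  have h2 := passageTime_le ω ((γ'.takeUntil z hz').append (γ.dropUntil z hz))
  have h3 := congrArg (pathTime ω) (γ.take_spec hz)
  have h4 := congrArg (pathTime ω) (γ'.take_spec hz')
  rw [pathTime_append] at h1 h2 h3 h4
  linarith

theorem busemann_antitoneOn (h : IsBoundaryPath V w v) (hV : (latticeOn V).Connected)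
    (hVc : (latticeOn Vᶜ).Connected) (ω : Configuration V) {i j : ℤ} (hij : i ≤ j) :
    AntitoneOn (fun n : ℤ => busemann ω v n (v i) (v j)) (Set.Ici j) := by
  intro n hn m _ hnm
  have := h.passageTime_exchange hV hVc ω hij hn hnm
  simp only [busemann]
  linarith

theorem exists_tendsto_busemann (h : IsBoundaryPath V w v) (hV : (latticeOn V).Connected)
    (hVc : (latticeOn Vᶜ).Connected) (ω : Configuration V) (i j : ℤ) :
    ∃ B : ℝ, Tendsto (fun n : ℤ => busemann ω v n (v i) (v j)) atTop (𝓝 B) := by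
  wlog hij : i ≤ j generalizing i j
  · obtain ⟨B, hB⟩ := this j i (le_of_not_ge hij)
    exact ⟨-B, hB.neg.congr fun n => neg_sub _ _⟩
  -- Truncating the index at `j` turns monotonicity on a half-line into monotonicity on ℤ.
  have hanti : Antitone (fun n : ℤ => busemann ω v (max n j) (v i) (v j)) := fun n m hnm =>
    h.busemann_antitoneOn hV hVc ω hij (Set.mem_Ici.2 (le_max_right _ _))
      (Set.mem_Ici.2 (le_max_right _ _)) (max_le_max_right _ hnm)
  have hbdd : BddBelow (Set.range fun n : ℤ => busemann ω v (max n j) (v i) (v j)) := by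
    refine ⟨-passageTime ω (v j) (v i), ?_⟩
    rintro _ ⟨n, rfl⟩
    have := passageTime_triangle (ω := ω) hV (v j) (v i) (v (max n j))
    simp only [busemann]
    linarith
  refine ⟨_, (tendsto_atTop_ciInf hanti hbdd).congr' ?_⟩
  filter_upwards [eventually_ge_atTop j] with n hn
  rw [max_eq_left hn]

/-! ### Cutting a finite connected set out of `V` -/

theorem index_eq {i : ℤ} {p q : ℤ × ℤ} (h : IsBoundaryPath V w v) (hp : p ∈ V)
    (hb : Bisects (w i) (w (i + 1)) p q) : (v i).1 = p := by
  obtain ⟨q', hq', hb'⟩ := h.crosses i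
  rcases hb'.eq_or_eq hb with ⟨h1, -⟩ | ⟨-, h1⟩
  · exact h1
  · exact absurd (h1 ▸ hp) hq'

/-- Consecutive inner endpoints on the boundary path are joined inside a face. -/
theorem joined_succ (h : IsBoundaryPath V w v) (n : ℤ) :
    (v (n + 1)).1 = v n ∨ squareLattice.Adj (v n).1 (v (n + 1)) ∨
      ∃ r ∈ V, squareLattice.Adj (v n).1 r ∧ squareLattice.Adj r (v (n + 1)) := by
  obtain ⟨q, hq, hb⟩ := h.crosses n
  obtain ⟨e, p', q', hp', hq', hb', hne, hj, -, -⟩ := exists_next (v n).2 hq hb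
  obtain ⟨k, hk⟩ := h.exhausts p' q' hp' hq' hb'.2.1
  rcases hk.eq_or_eq_dual hb' with ⟨h1, h2⟩ | ⟨h1, h2⟩
  · obtain rfl := h.selfAvoiding h1
    rwa [h.index_eq hp' hk]
  -- In this case the continuation would retrace step `n` backwards, which `e ≠ w n` excludes.
  · obtain rfl : k = n := by
      have := h.selfAvoiding h2
      omega
    exact absurd h1.symm hne

/-- A self-avoiding path leaves every bounded region. Radius 2 also covers the intermediate vertex
`r` in `joined_succ`. -/
theorem finite_near (h : IsBoundaryPath V w v) {K : Set (ℤ × ℤ)} (hK : K.Finite) :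
    {n | ∃ z ∈ K, |z.1 - (w n).1| ≤ 2 ∧ |z.2 - (w n).2| ≤ 2}.Finite := by
  have h1 : (⋃ z ∈ K, Set.Icc (z.1 - 2) (z.1 + 2) ×ˢ Set.Icc (z.2 - 2) (z.2 + 2)).Finite :=
    hK.biUnion fun z _ => (Set.finite_Icc _ _).prod (Set.finite_Icc _ _)
  refine (h1.preimage h.selfAvoiding.injOn).subset ?_
  rintro n ⟨z, hz, h1, h2⟩
  simp only [Set.mem_preimage, Set.mem_iUnion, Set.mem_prod, Set.mem_Icc]
  exact ⟨z, hz, by grind⟩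

theorem near (h : IsBoundaryPath V w v) (n : ℤ) :
    |(v n).1.1 - (w n).1| ≤ 1 ∧ |(v n).1.2 - (w n).2| ≤ 1 := by
  obtain ⟨q, -, hb⟩ := h.crosses n
  simp only [Bisects, squareLattice_adj_iff, Prod.ext_iff, Prod.fst_add, Prod.snd_add] at hb
  rw [abs_le, abs_le]
  omega

/-- Removing from `V` a finite connected set that touches the complement of `V` leaves a component
that contains the tail of the boundary path and has again a connected complement. -/
theorem exists_component (h : IsBoundaryPath V w v) (hV : (latticeOn V).Connected)
    (hVc : Vᶜ.Infinite) (hVcconn : (latticeOn Vᶜ).Connected) {K : Set (ℤ × ℤ)} (hK : K.Finite)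
    (h0 : (v 0).1 ∈ K) (hKconn : (latticeOn K).Connected) :
    ∃ V' ⊆ V, Disjoint V' K ∧ V'.Infinite ∧ (latticeOn V').Connected ∧ V'ᶜ.Infinite ∧
      (latticeOn V'ᶜ).Connected ∧ (∃ N, ∀ n ≥ N, (v n).1 ∈ V') ∧
      ∀ x ∈ V, ∀ y ∈ V', squareLattice.Adj x y → x ∉ V' → x ∈ K := by
  obtain ⟨M, hM⟩ := (h.finite_near hK).bddAbove
  have hfar : ∀ n, M + 1 ≤ n → ∀ z : ℤ × ℤ,
      |z.1 - (w n).1| ≤ 2 ∧ |z.2 - (w n).2| ≤ 2 → z ∉ K := fun n hn z hz hzK => by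
    have := hM (⟨z, hzK, hz⟩ : n ∈ {n | ∃ z ∈ K, |z.1 - (w n).1| ≤ 2 ∧ |z.2 - (w n).2| ≤ 2})
    omega
  have hvK : ∀ n, M + 1 ≤ n → (v n).1 ∈ V \ K := fun n hn =>
    ⟨(v n).2, hfar n hn _ ⟨(h.near n).1.trans (by norm_num), (h.near n).2.trans (by norm_num)⟩⟩
  set V' : Set (ℤ × ℤ) := {z | ∃ hz : z ∈ V \ K,
    (latticeOn (V \ K)).Reachable ⟨v (M + 1), hvK _ le_rfl⟩ ⟨z, hz⟩} with hV'
  have hsub : V' ⊆ V \ K := fun z ⟨hz, _⟩ => hz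
  have hadj : ∀ x ∈ V', ∀ y ∈ V \ K, squareLattice.Adj x y → y ∈ V' := fun x ⟨hx, hr⟩ y hy hxy =>
    ⟨hy, hr.trans (SimpleGraph.Adj.reachable
      (show (latticeOn (V \ K)).Adj ⟨x, hx⟩ ⟨y, hy⟩ from hxy))⟩
  have htail : ∀ n ≥ M + 1, (v n).1 ∈ V' := by
    intro n hn
    induction n, hn using Int.leInduction with
    | base => exact ⟨hvK _ le_rfl, .rfl⟩
    | succ n hn ih =>
      have h2 := hvK (n + 1) (by omega)
      rcases h.joined_succ n with h1 | h1 | ⟨r, hr, h1, h3⟩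
      · rwa [h1]
      · exact hadj _ ih _ h2 h1
      · refine hadj r (hadj _ ih r ⟨hr, hfar n hn r ?_⟩ h1) _ h2 h3
        have h4 := h.near n
        have h5 := squareLattice_adj_iff.1 h1
        rw [abs_le, abs_le] at h4 ⊢
        omega
  have hbase := htail _ le_rfl
  refine ⟨V', hsub.trans Set.sdiff_subset, Set.disjoint_left.2 fun z hz => (hsub hz).2, ?_, ?_, ?_,
    ?_, ⟨M + 1, htail⟩, ?_⟩
  · intro hfin
    refine Set.Ici_infinite (M + 1) ((h.finite_near hfin).subset fun n hn => ?_)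
    exact ⟨_, htail n hn, (h.near n).1.trans (by norm_num), (h.near n).2.trans (by norm_num)⟩
  · refine connected_of_forall_subset hbase fun S haS hS => ?_
    have key : ∀ {x y : (V \ K : Set (ℤ × ℤ))} (_ : (latticeOn (V \ K)).Walk x y),
        x.1 ∈ V' → x.1 ∈ S → y.1 ∈ S := by
      intro x y γ
      induction γ with
      | nil => exact fun _ => id
      | cons hxy γ ih =>
        intro hx hxS
        have hy := hadj _ hx _ (Subtype.mem _) hxy
        exact ih hy (hS _ hxS _ hy hx hxy)
    rintro z ⟨hz, ⟨γ⟩⟩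
    exact key γ hbase haS
  · exact hVc.mono (Set.compl_subset_compl.2 (hsub.trans Set.sdiff_subset))
  · obtain ⟨q, hq, hb⟩ := h.crosses 0
    have hKV' : K ⊆ V'ᶜ := fun z hz hz' => (hsub hz').2 hz
    have hVV' : Vᶜ ⊆ V'ᶜ := Set.compl_subset_compl.2 (hsub.trans Set.sdiff_subset)
    refine connected_of_forall_subset (hVV' hq) fun S hqS hS => ?_
    have h1 : Vᶜ ⊆ S := subset_of_connected hVcconn hq hqS fun x hx y hy hxV hxy =>
      hS x hx y (hVV' hy) (hVV' hxV) hxy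
    have h2 : K ⊆ S := subset_of_connected hKconn h0
      (hS q hqS _ (hKV' h0) (hVV' hq) hb.2.1.symm) fun x hx y hy hxK hxy =>
      hS x hx y (hKV' hy) (hKV' hxK) hxy
    -- A walk in `V` can leave `V'` only into `K`, so the other components of `V \ K` are attached
    -- to `K` without passing through `V'`.
    have h3 : V ⊆ S ∪ V' := subset_of_connected hV (v 0).2 (.inl (h2 h0)) (by
      intro x hx y hy hxV hxy
      by_cases hyV' : y ∈ V'
      · exact .inr hyV'
      by_cases hyK : y ∈ K
      · exact .inl (h2 hyK)
      have hxV' : x ∉ V' := fun hx' => hyV' (hadj x hx' y ⟨hy, hyK⟩ hxy)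
      exact .inl (hS x (hx.resolve_right hxV') y hyV' hxV' hxy))
    intro z hz
    by_cases hzV : z ∈ V
    · exact (h3 hzV).resolve_right hz
    · exact h1 hzV
  · intro x hx y hy hxy hxV'
    by_contra hxK
    exact hxV' (hadj y hy x ⟨hx, hxK⟩ hxy.symm)

/-- A boundary edge of `V` with inner endpoint in `V'` is also one of `V'`. Once the orientations
agree at step `N`, self-avoidance prevents the second path from turning back, so the two follow the
same dual edges from there on. -/
theorem exists_tail_index {V' : Set (ℤ × ℤ)} {w' : ℤ → ℤ × ℤ} {v' : ℤ → V'}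
    (h : IsBoundaryPath V w v) (h' : IsBoundaryPath V' w' v') (hV' : V' ⊆ V) {N : ℤ}
    (hN : ∀ n ≥ N, (v n).1 ∈ V') :
    ∃ w'' v'', IsBoundaryPath V' w'' v'' ∧ ∃ c, ∀ n ≥ N, (v'' (n + c)).1 = v n := by
  have key : ∀ (w' : ℤ → ℤ × ℤ) (v' : ℤ → V'), IsBoundaryPath V' w' v' →
      ∀ k, w' k = w N → w' (k + 1) = w (N + 1) → ∃ c, ∀ n ≥ N, (v' (n + c)).1 = v n := by
    intro w' v' h' k hk hk'
    have hw : ∀ n ≥ N, w' (n + (k - N)) = w n ∧ w' (n + (k - N) + 1) = w (n + 1) := by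
      intro n hn
      induction n, hn using Int.leInduction with
      | base => simp [hk, hk']
      | succ n hn ih =>
        obtain ⟨q, hq, hb⟩ := h.crosses (n + 1)
        obtain ⟨l, hl⟩ := h'.exhausts _ q (hN (n + 1) (by omega)) (fun hh => hq (hV' hh)) hb.2.1
        rw [add_right_comm]
        rcases hl.eq_or_eq_dual hb with ⟨h1, h2⟩ | ⟨h1, h2⟩
        · obtain rfl := h'.selfAvoiding (h1.trans ih.2.symm)
          exact ⟨ih.2, h2⟩
        · have h3 := h'.selfAvoiding (h2.trans ih.2.symm)
          obtain rfl : l = n + (k - N) := by omega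
          have h4 := h.selfAvoiding (h1.symm.trans ih.1)
          omega
    refine ⟨k - N, fun n hn => ?_⟩
    obtain ⟨q, hq, hb⟩ := h.crosses n
    refine h'.index_eq (q := q) (hN n hn) ?_
    rwa [(hw n hn).1, (hw n hn).2]
  obtain ⟨q, hq, hb⟩ := h.crosses N
  obtain ⟨k, hk⟩ := h'.exhausts _ q (hN N le_rfl) (fun hh => hq (hV' hh)) hb.2.1
  rcases hk.eq_or_eq_dual hb with ⟨h1, h2⟩ | ⟨h1, h2⟩
  · exact ⟨w', v', h', key w' v' h' k h1 h2⟩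
  · refine ⟨_, _, h'.reverse, key _ _ h'.reverse (-k - 1) ?_ ?_⟩
    · rwa [show -(-k - 1) = k + 1 by ring]
    · rwa [show -(-k - 1 + 1) = k by ring]

end IsBoundaryPath

/-! ### Last entrance into a smaller vertex set -/

/-- The restriction of a configuration to a smaller vertex set. -/
def Configuration.restrict {V V' : Set (ℤ × ℤ)} (hV' : V' ⊆ V) (ω : Configuration V) :
    Configuration V' :=
  fun e => ω ((squareLattice.induceHomOfLE hV').toHom.mapEdgeSet e)

theorem passageTime_le_restrict {V V' : Set (ℤ × ℤ)} (hV' : V' ⊆ V) (ω : Configuration V)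
    (hconn : (latticeOn V').Connected) (x y : V') :
    passageTime ω (Set.inclusion hV' x) (Set.inclusion hV' y) ≤
      passageTime (ω.restrict hV') x y := by
  refine le_passageTime hconn fun γ => ?_
  suffices H : ∃ γ' : (latticeOn V).Walk (Set.inclusion hV' x) (Set.inclusion hV' y),
      pathTime ω γ' = pathTime (ω.restrict hV') γ by
    obtain ⟨γ', hγ'⟩ := H
    exact hγ' ▸ passageTime_le ω γ'
  induction γ with
  | nil => exact ⟨.nil, rfl⟩
  | @cons a b _ hab γ ih =>
    obtain ⟨γ', hγ'⟩ := ih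
    refine ⟨.cons (v := Set.inclusion hV' b) hab γ', ?_⟩
    exact congrArg (_ + ·) hγ'

/-- A walk into `V'` either stays in `V'` or has a last entrance edge. -/
theorem pathTime_ge_of_entrance {V V' : Set (ℤ × ℤ)} (hV' : V' ⊆ V) (ω : Configuration V)
    (hconn : (latticeOn V).Connected) (hconn' : (latticeOn V').Connected) {x y : V} (γ : (latticeOn V).Walk x y) (hy : y.1 ∈ V') :
    (∃ hx : x.1 ∈ V', passageTime (ω.restrict hV') ⟨x, hx⟩ ⟨y, hy⟩ ≤ pathTime ω γ) ∨
    ∃ (a : V) (b : V') (hab : (latticeOn V).Adj a (Set.inclusion hV' b)), a.1 ∉ V' ∧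
      passageTime ω x a + ω ⟨s(a, Set.inclusion hV' b), hab⟩ +
        passageTime (ω.restrict hV') b ⟨y, hy⟩ ≤ pathTime ω γ := by
  induction γ with
  | nil => exact .inl ⟨hy, (passageTime_self _ _).le⟩
  | @cons x z y hxz γ ih =>
    rw [pathTime]
    rcases ih hy with ⟨hz, h⟩ | ⟨a, b, hab, ha, h⟩
    · by_cases hx : x.1 ∈ V'
      · refine .inl ⟨hx, ?_⟩
        have := passageTime_le_edge (ω := ω.restrict hV') (V := V') (x := ⟨x, hx⟩) (y := ⟨z, hz⟩)
          hconn' hxz ⟨y, hy⟩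
        exact this.trans (add_le_add le_rfl h)
      · refine .inr ⟨x, ⟨z, hz⟩, hxz, hx, ?_⟩
        rw [passageTime_self, zero_add]
        exact add_le_add le_rfl h
    · refine .inr ⟨a, b, hab, ha, ?_⟩
      have := passageTime_le_edge (ω := ω) hconn hxz a
      linarith

theorem connected_walk_support {V : Set (ℤ × ℤ)} {x y : V} (γ : (latticeOn V).Walk x y) :
    (latticeOn (Subtype.val '' {z | z ∈ γ.support})).Connected := by
  refine connected_of_forall_subset ⟨x, γ.start_mem_support, rfl⟩ fun S hxS hS => ?_
  have key : ∀ {a b : V} (α : (latticeOn V).Walk a b), (∀ z ∈ α.support, z ∈ γ.support) →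
      a.1 ∈ S → ∀ z ∈ α.support, z.1 ∈ S := by
    intro a b α
    induction α with
    | nil =>
      intro _ ha z hz
      rw [SimpleGraph.Walk.support_nil, List.mem_singleton] at hz
      rwa [hz]
    | @cons a b _ hab α ih =>
      intro hs ha z hz
      have hs' : ∀ z ∈ α.support, z ∈ γ.support := fun z hz => hs z (List.mem_cons_of_mem _ hz)
      rw [SimpleGraph.Walk.support_cons, List.mem_cons] at hz
      rcases hz with rfl | hz
      · exact ha
      · exact ih hs' (hS _ ha _ ⟨b, hs' b α.start_mem_support, rfl⟩
          ⟨a, hs a (SimpleGraph.Walk.start_mem_support _), rfl⟩ hab) z hz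
  rintro _ ⟨z, hz, rfl⟩
  exact key γ (fun _ => id) hxS z hz

/-! ### Convergence for general points -/

namespace IsBoundaryPath

variable {V : Set (ℤ × ℤ)} {w : ℤ → ℤ × ℤ} {v : ℤ → V}

theorem exists_tendsto_busemann_start (h : IsBoundaryPath V w v) (hV : (latticeOn V).Connected)
    (hVc : Vᶜ.Infinite) (hVcconn : (latticeOn Vᶜ).Connected) (ω : Configuration V) (x : V) :
    ∃ B : ℝ, Tendsto (fun n : ℤ => busemann ω v n x (v 0)) atTop (𝓝 B) := by
  obtain ⟨γ⟩ := hV.preconnected x (v 0)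
  set K : Set (ℤ × ℤ) := Subtype.val '' {z | z ∈ γ.support} with hKdef
  have hK : K.Finite := (List.finite_toSet γ.support).image _
  have hxK : x.1 ∈ K := ⟨x, γ.start_mem_support, rfl⟩
  have h0K : (v 0).1 ∈ K := ⟨_, γ.end_mem_support, rfl⟩
  obtain ⟨V', hV', hdisj, hinf, hconn', hinf', hcconn', ⟨N, hN⟩, hentr⟩ :=
    h.exists_component hV hVc hVcconn hK h0K (connected_walk_support γ)
  obtain ⟨w₀, v₀, h₀⟩ := exists_isBoundaryPath hinf hconn' hinf' hcconn'
  obtain ⟨w', v', h', c, hc⟩ := h.exists_tail_index h₀ hV' hN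
  have hvv : ∀ n, ∀ hn : n ≥ N, v' (n + c) = ⟨v n, hN n hn⟩ := fun n hn => Subtype.ext (hc n hn)
  set τ' : V' → V' → ℝ := passageTime (ω.restrict hV') with hτ'
  -- These are the entrance edges into `V'`. Their outer endpoints lie in the finite set `K`, so
  -- there are finitely many.
  let ι := {e : V × V' // (latticeOn V).Adj e.1 (Set.inclusion hV' e.2) ∧ e.1.1 ∉ V'}
  have : Finite ι := by
    have hfin : (⋃ z ∈ K, ({z} : Set (ℤ × ℤ)) ×ˢ
        (Set.Icc (z.1 - 1) (z.1 + 1) ×ˢ Set.Icc (z.2 - 1) (z.2 + 1))).Finite :=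
      hK.biUnion fun z _ => (Set.finite_singleton z).prod
        ((Set.finite_Icc _ _).prod (Set.finite_Icc _ _))
    have := hfin.to_subtype
    refine Finite.of_injective (fun e : ι => (⟨(e.1.1.1, e.1.2.1), ?_⟩ :
      (⋃ z ∈ K, ({z} : Set (ℤ × ℤ)) ×ˢ
        (Set.Icc (z.1 - 1) (z.1 + 1) ×ˢ Set.Icc (z.2 - 1) (z.2 + 1)) : Set _))) ?_
    · have h1 : squareLattice.Adj e.1.1.1 e.1.2.1 := e.2.1
      have h2 : e.1.1.1 ∈ K := hentr _ e.1.1.2 _ e.1.2.2 h1 e.2.2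
      rw [squareLattice_adj_iff] at h1
      simp only [Set.mem_iUnion, Set.mem_prod, Set.mem_singleton_iff, Set.mem_Icc]
      exact ⟨_, h2, rfl, by omega⟩
    · intro e f hef
      simp only [Subtype.mk.injEq, Prod.mk.injEq] at hef
      exact Subtype.ext (Prod.ext (Subtype.ext hef.1) (Subtype.ext hef.2))
  have := Fintype.ofFinite ι
  let A : V → ι → ℝ := fun a e =>
    passageTime ω a e.1.1 + ω ⟨s(e.1.1, Set.inclusion hV' e.1.2), e.2.1⟩
  have hentrance : ∀ a : V, a.1 ∈ K → ∀ n, ∀ hn : n ≥ N, ∀ γ : (latticeOn V).Walk a (v n),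
      ∃ e : ι, A a e + τ' e.1.2 (v' (n + c)) ≤ pathTime ω γ := by
    intro a ha n hn γ
    rcases pathTime_ge_of_entrance hV' ω hV hconn' γ (hN n hn) with ⟨hx, -⟩ | ⟨a, b, hab, ha, hle⟩
    · exact absurd ha (Set.disjoint_left.1 hdisj hx)
    · refine ⟨⟨(a, b), hab, ha⟩, ?_⟩
      rw [hvv n hn]
      exact hle
  have hne : (Finset.univ : Finset ι).Nonempty := by
    obtain ⟨α⟩ := hV.preconnected (v 0) (v N)
    obtain ⟨e, -⟩ := hentrance _ h0K N le_rfl α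
    exact ⟨e, Finset.mem_univ e⟩
  have hformula : ∀ a : V, a.1 ∈ K → ∀ n ≥ N, passageTime ω a (v n) =
      Finset.univ.inf' hne fun e => A a e + τ' e.1.2 (v' (n + c)) := by
    intro a ha n hn
    refine le_antisymm (Finset.le_inf' _ _ fun e _ => ?_) (le_passageTime hV fun γ => ?_)
    · have h1 := passageTime_triangle (ω := ω) hV a e.1.1 (v n)
      have h2 := passageTime_le_edge (ω := ω) hV e.2.1 (v n)
      have h3 := passageTime_le_restrict hV' ω hconn' e.1.2 (v' (n + c))
      rw [show Set.inclusion hV' (v' (n + c)) = v n from Subtype.ext (hc n hn)] at h3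
      simp only [A]
      linarith
    · obtain ⟨e, he⟩ := hentrance a ha n hn γ
      exact (Finset.inf'_le _ (Finset.mem_univ e)).trans he
  -- The subtracted reference does not depend on `a` and cancels in the final difference; it turns
  -- each entry of the minimum into a constant plus a Busemann function of `V'`.
  have hlim : ∀ a : V, a.1 ∈ K → ∃ L : ℝ,
      Tendsto (fun n : ℤ => passageTime ω a (v n) - τ' (v' 0) (v' (n + c))) atTop (𝓝 L) := by
    intro a ha
    have hB : ∀ e : ι, ∃ B : ℝ, Tendsto
        (fun n : ℤ => A a e + busemann (ω.restrict hV') v' (n + c) e.1.2 (v' 0)) atTop (𝓝 B) := by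
      intro e
      -- An entrance edge joins `V'` to its complement, so its inner endpoint is on the boundary
      -- path of `V'`.
      obtain ⟨k, hk⟩ := h'.exhausts _ _ e.1.2.2 e.2.2 e.2.1.symm
      obtain ⟨B, hB⟩ := h'.exists_tendsto_busemann hconn' hcconn' (ω.restrict hV') k 0
      rw [Subtype.ext (h'.index_eq e.1.2.2 hk)] at hB
      exact ⟨_, tendsto_const_nhds.add (hB.comp (tendsto_atTop_add_const_right _ c tendsto_id))⟩
    choose B hB using hB
    refine ⟨_, (Filter.Tendsto.finset_inf'_nhds_apply hne fun e _ => hB e).congr' ?_⟩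
    filter_upwards [eventually_ge_atTop N] with n hn
    rw [hformula a ha n hn]
    apply le_antisymm
    · rw [le_sub_iff_add_le]
      refine Finset.le_inf' _ _ fun e _ => ?_
      rw [← le_sub_iff_add_le]
      refine (Finset.inf'_le _ (Finset.mem_univ e)).trans (le_of_eq ?_)
      simp only [busemann, hτ']
      ring
    · refine Finset.le_inf' _ _ fun e _ => ?_
      rw [sub_le_iff_le_add]
      refine (Finset.inf'_le _ (Finset.mem_univ e)).trans (le_of_eq ?_)
      simp only [busemann, hτ']
      ring
  obtain ⟨L₁, h₁⟩ := hlim x hxK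
  obtain ⟨L₂, h₂⟩ := hlim (v 0) h0K
  exact ⟨_, (h₁.sub h₂).congr fun n => by simp only [busemann]; ring⟩

end IsBoundaryPath

theorem theorem1 (V : Set (ℤ × ℤ)) (hV : V.Infinite) (hVconn : (latticeOn V).Connected)
    (hVc : Vᶜ.Infinite) (hVcconn : (latticeOn Vᶜ).Connected) :
    (∃ (w : ℤ → ℤ × ℤ) (v : ℤ → V), IsBoundaryPath V w v) ∧
    ∀ (w : ℤ → ℤ × ℤ) (v : ℤ → V), IsBoundaryPath V w v →
      ∀ ω : Configuration V,
        (∀ x y : V, ∃ B : ℝ, Tendsto (fun n : ℤ => busemann ω v n x y) atTop (𝓝 B)) ∧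
        (∀ i j : ℤ, i ≤ j →
          AntitoneOn (fun n : ℤ => busemann ω v n (v i) (v j)) (Set.Ici j)) := by
  refine ⟨exists_isBoundaryPath hV hVconn hVc hVcconn, fun w v h ω => ⟨fun x y => ?_,
    fun i j hij => h.busemann_antitoneOn hVconn hVcconn ω hij⟩⟩
  obtain ⟨B₁, h₁⟩ := h.exists_tendsto_busemann_start hVconn hVc hVcconn ω x
  obtain ⟨B₂, h₂⟩ := h.exists_tendsto_busemann_start hVconn hVc hVcconn ω y
  exact ⟨_, (h₁.sub h₂).congr fun n => sub_sub_sub_cancel_right _ _ _⟩
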